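/- Consider the focusing nonlocal derivative NLS equation $$ i u_t = u_{xx} + \sigma\, u\,(i + H)\,(|u|^2)_x, \qquad \sigma = -1, \quad (x,t)\in\mathbb{R}\times\mathbb{R}, \qquad H(F)(x) = \frac1\pi\,\mathrm{p.v.}\!\int_{-\infty}^{\infty} \frac{F(y)\,dy}{y-x}. $$ Let $k_1>0$, $\phi_1>0$, $k_2\in\mathbb{R}\setminus\{0\}$, $x_1,x_2\in\mathbb{R}$, let $c_1=-k_1$, and let $c_2\in\mathbb{R}$ belong to one of the two intervals $$ c_2\in(|k_2|,\infty) \qquad\text{or}\qquad c_2\in(-\infty,-|k_2|-2k_1). $$ Put $\xi_j = x-c_jt-x_j$ for $j=1,2$, and $$ \alpha_2=\frac{c_2-k_2}{c_2+k_2},\qquad e^{-A_{12}}=\frac{(c_1-c_2)^2-(k_1+k_2)^2}{(c_1-c_2)^2-(k_1-k_2)^2}=\frac{(c_2-k_2)(c_2+2k_1+k_2)}{(c_2+k_2)(c_2+2k_1-k_2)},\qquad \gamma_{12}^2=k_1(e^{2\phi_1}-1)\frac{c_2+k_2}{c_2-k_2}. $$ Then real numbers $A_{12}$ and $\gamma_{12}\neq0$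 with these properties exist (the right-hand sides are positive), and for each such choice define $$\begin{aligned} f&=1+e^{ik_1\xi_1-\phi_1-\frac12A_{12}}+e^{ik_2\xi_2-\frac12A_{12}}+e^{ik_1\xi_1-\phi_1+ik_2\xi_2},\\ \tilde f&=1+e^{ik_1\xi_1+\phi_1-\frac12A_{12}}+e^{ik_2\xi_2-\frac12A_{12}}+e^{ik_1\xi_1+\phi_1+ik_2\xi_2},\\ g&=\gamma_{12}\big[e^{ik_1\xi_1-\phi_1-\frac12A_{12}}+\alpha_2e^{ik_1\xi_1-\phi_1+ik_2\xi_2}\big],\\ \tilde g&=\gamma_{12}\big[e^{ik_2\xi_2-\frac12A_{12}}+\alpha_2\big]. \end{aligned}$$ The following hold. 1. For every $t\in\mathbb{R}$, all zeros of $f(\cdot,t)$ in the complex $x$-plane satisfy $\operatorname{Im}x<0$, and all zeros of $\tilde f(\cdot,t)$ satisfy $\operatorname{Im}x>0$. 2. The function $u=g/f$ is a ($C^2$, classical) solution of the equation on $\mathbb{R}\times\mathbb{R}$; in particular the principal value $H\big((|u|^2)_x\big)(x)$ exists for all $x,t\in\mathbb{R}$. Moreover, for all $x,t\in\mathbb{R}$,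 $$ u=\frac gf,\qquad \bar u=\frac{\tilde g}{\tilde f},\qquad |u|^2=i\,\frac{\partial}{\partial x}\ln\frac{f}{\tilde f}. $$ 3. The solution is $2$-periodic: $u(x,t)=U\big(k_1(x-c_1t),k_2(x-c_2t)\big)$ for a continuous function $U:\mathbb{R}^2\to\mathbb{C}$ that is $2\pi$-periodic in each variable. -/

import Mathlib

open Filter Topology

noncomputable section

namespace NDNLS

/-- `HasHilbertTransform F x h`: the Hilbert transform
`(1 / π) p.v. ∫ F(y) / (y - x) dy` of `F` at the point `x` exists and equals `h`.
The principal value is taken symmetrically at `y = x` and at infinity, and the two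
truncations are removed independently of each other. -/
def HasHilbertTransform (F : ℝ → ℝ) (x h : ℝ) : Prop :=
  Tendsto
    (fun p : ℝ × ℝ =>
      1 / Real.pi * ∫ y in {y : ℝ | p.1 < |y - x| ∧ |y - x| < p.2}, F y / (y - x))
    (𝓝[>] (0 : ℝ) ×ˢ atTop) (𝓝 h)

/-- Classical solutions `u(x, t)` on `ℝ × ℝ` of
`i u_t = u_xx + σ u (i + H) (|u|²)_x`. -/
def IsClassicalSolution (σ : ℝ) (u : ℝ → ℝ → ℂ) : Prop :=
  ContDiff ℝ 2 (fun p : ℝ × ℝ => u p.1 p.2) ∧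
  ∀ x t : ℝ, ∃ h : ℝ,
    HasHilbertTransform (deriv fun y : ℝ => ‖u y t‖ ^ 2) x h ∧
    Complex.I * deriv (fun s : ℝ => u x s) t =
      deriv (deriv fun y : ℝ => u y t) x +
        (σ : ℂ) * u x t *
          (Complex.I * ((deriv (fun y : ℝ => ‖u y t‖ ^ 2) x : ℝ) : ℂ) + (h : ℂ))

/-- `u` is a two-phase wave: a continuous function of the phases `k₁ (x - c₁ t)` and
`k₂ (x - c₂ t)` that is `2π`-periodic in each of them. -/
def IsTwoPeriodicWave (k₁ k₂ c₁ c₂ : ℝ) (u : ℝ → ℝ → ℂ) : Prop :=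
  ∃ U : ℝ → ℝ → ℂ, Continuous (fun p : ℝ × ℝ => U p.1 p.2) ∧
    (∀ a b, U (a + 2 * Real.pi) b = U a b) ∧
    (∀ a b, U a (b + 2 * Real.pi) = U a b) ∧
    ∀ x t, u x t = U (k₁ * (x - c₁ * t)) (k₂ * (x - c₂ * t))

/-- The bilinear representation on the zero background for `σ = -1`:
`u = g / f`, `ū = g̃ / f̃`, `|u|² = i ∂ₓ ln (f / f̃)` for real `x` and `t`. -/
def HasBilinearRepresentation (u : ℝ → ℝ → ℂ) (f f' g g' : ℂ → ℝ → ℂ) : Prop :=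
  ∀ x t : ℝ,
    f x t ≠ 0 ∧ f' x t ≠ 0 ∧
    u x t = g x t / f x t ∧
    (starRingEnd ℂ) (u x t) = g' x t / f' x t ∧
    ((‖u x t‖ ^ 2 : ℝ) : ℂ) =
      Complex.I * logDeriv (fun y : ℝ => f y t / f' y t) x

/-- The free real parameters of the two-periodic wave. -/
structure Params where
  k₁ : ℝ
  k₂ : ℝ
  c₂ : ℝ
  φ₁ : ℝ
  x₁ : ℝ
  x₂ : ℝ

namespace Params

variable (p : Params)

/-- The speed `c₁ = -k₁`. -/
def c₁ : ℝ := -p.k₁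

/-- `α₂ = (c₂ - k₂) / (c₂ + k₂)`. -/
def α₂ : ℝ := (p.c₂ - p.k₂) / (p.c₂ + p.k₂)

/-- The value prescribed for `exp (-A₁₂)`. -/
def interaction : ℝ :=
  ((p.c₁ - p.c₂) ^ 2 - (p.k₁ + p.k₂) ^ 2) / ((p.c₁ - p.c₂) ^ 2 - (p.k₁ - p.k₂) ^ 2)

/-- The value prescribed for `γ₁₂ ^ 2`. -/
def gammaSq : ℝ :=
  p.k₁ * (Real.exp (2 * p.φ₁) - 1) * ((p.c₂ + p.k₂) / (p.c₂ - p.k₂))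

/-- `ξ₁ = x - c₁ t - x₁`, for complex `x`. -/
def ξ₁ (x : ℂ) (t : ℝ) : ℂ := x - p.c₁ * t - p.x₁

/-- `ξ₂ = x - c₂ t - x₂`, for complex `x`. -/
def ξ₂ (x : ℂ) (t : ℝ) : ℂ := x - p.c₂ * t - p.x₂

/-- The function `f`. -/
def f (A : ℝ) (x : ℂ) (t : ℝ) : ℂ :=
  1 + Complex.exp (Complex.I * p.k₁ * p.ξ₁ x t - p.φ₁ - A / 2)
    + Complex.exp (Complex.I * p.k₂ * p.ξ₂ x t - A / 2)
    + Complex.exp (Complex.I * p.k₁ * p.ξ₁ x t - p.φ₁ + Complex.I * p.k₂ * p.ξ₂ x t)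

/-- The function `f̃`. -/
def fTilde (A : ℝ) (x : ℂ) (t : ℝ) : ℂ :=
  1 + Complex.exp (Complex.I * p.k₁ * p.ξ₁ x t + p.φ₁ - A / 2)
    + Complex.exp (Complex.I * p.k₂ * p.ξ₂ x t - A / 2)
    + Complex.exp (Complex.I * p.k₁ * p.ξ₁ x t + p.φ₁ + Complex.I * p.k₂ * p.ξ₂ x t)

/-- The function `g`. -/
def g (A γ : ℝ) (x : ℂ) (t : ℝ) : ℂ :=
  γ * (Complex.exp (Complex.I * p.k₁ * p.ξ₁ x t - p.φ₁ - A / 2)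
    + p.α₂ *
      Complex.exp (Complex.I * p.k₁ * p.ξ₁ x t - p.φ₁ + Complex.I * p.k₂ * p.ξ₂ x t))

/-- The function `g̃`. -/
def gTilde (A γ : ℝ) (x : ℂ) (t : ℝ) : ℂ :=
  γ * (Complex.exp (Complex.I * p.k₂ * p.ξ₂ x t - A / 2) + p.α₂)

/-- The wave `u = g / f` at real `x`. -/
def u (A γ : ℝ) (x t : ℝ) : ℂ := p.g A γ x t / p.f A x t

end Params

end NDNLS

end

/-!
Write `X = exp (i k₁ ξ₁)`, `Y = exp (i k₂ ξ₂)`, `a = exp (-A / 2)` and `r = exp (-φ₁) < 1`. Then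
`f = 1 + a r X + a Y + r X Y = (1 + a Y) + r X (a + Y)`, and `f̃` is the same expression with `r⁻¹`
in place of `r`.

*Zeros.* Reversing the sign of `k₂` replaces `a` by `a⁻¹` and multiplies `f` and `g` by a common
factor without zeros (`f_eq_mul_reflect`, `g_eq_mul_reflect`), so `k₂ > 0` may be assumed. The
prescribed value of `a²` is then less than `1`, because its numerator and denominator have the same
sign and differ by `4 k₁ k₂`. In the closed upper half-plane `|X|, |Y| ≤ 1`, where
`|a + Y| ≤ |1 + a Y|`; hence `f` has no zeros there (`tau_ne_zero`). Zeros of `f̃` are complex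
conjugates of zeros of `f`, since `conj (f (conj z)) X Y = r f̃ z`.

*The modulus.* On the real line `conj u = g̃ / f̃`, and the relation between `γ²`, `α₂` and `a²` gives
`g g̃ = i (fₓ f̃ - f f̃ₓ)`, that is `|u|² = i (ln (f / f̃))ₓ`. As `f̃` is `conj f` times a plane wave,
this reads `|u|² = -2 Im (fₓ / f) + k₁ + k₂` (`normSq_u_eq_im`).

*The equation.* The function `G = (ln f)''` is holomorphic and bounded on the closed upper half-plane
and tends to `0` as the imaginary part grows. Cauchy's theorem on a half annulus gives
`H (Im G) = Re G` (`hasHilbertTransform_im`); the integral over the large semicircle vanishes by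
dominated convergence, which requires no decay of `G` along the real line. Therefore
`(i + H) (|u|²)ₓ = -2 (ln f)''`, and the equation becomes the bilinear equation
`i (gₜ f - g fₜ) = gₓₓ f - 2 gₓ fₓ + g fₓₓ`, a polynomial identity in `X` and `Y`
(`bilinear_evolution`).
-/

noncomputable section

namespace NDNLS

/-! ### Hilbert transforms of boundary values -/

/-- In the logarithmic coordinate `s = log |y - x|` the kernel `1 / (y - x)` disappears. -/
theorem setIntegral_annulus_div_sub (F : ℝ → ℝ) (hF : Continuous F) (x : ℝ) {ε R : ℝ}
    (hε : 0 < ε) (hR : ε < R) :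
    ∫ y in {y : ℝ | ε < |y - x| ∧ |y - x| < R}, F y / (y - x) =
      ∫ s in Real.log ε..Real.log R, (F (x + Real.exp s) - F (x - Real.exp s)) := by
  have hset : {y : ℝ | ε < |y - x| ∧ |y - x| < R} =
      Set.Ioo (x - R) (x - ε) ∪ Set.Ioo (x + ε) (x + R) := by
    ext y
    simp only [Set.mem_ofPred_eq, Set.mem_union, Set.mem_Ioo]
    constructor
    · rintro ⟨h1, h2⟩
      rw [abs_lt] at h2
      rcases lt_abs.1 h1 with h | h
      · right; constructor <;> linarith
      · left; constructor <;> linarith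
    · rintro (⟨h1, h2⟩ | ⟨h1, h2⟩)
      · rw [abs_of_neg (by linarith)]; constructor <;> linarith
      · rw [abs_of_pos (by linarith)]; constructor <;> linarith
  have hdisj : Disjoint (Set.Ioo (x - R) (x - ε)) (Set.Ioo (x + ε) (x + R)) := by
    rw [Set.disjoint_left]
    rintro y ⟨_, h1⟩ ⟨h2, _⟩
    linarith
  have hcont : ∀ S : Set ℝ, x ∉ S → ContinuousOn (fun y => F y / (y - x)) S := by
    intro S hS
    refine hF.continuousOn.div (by fun_prop) fun y hy h => hS ?_
    rwa [← sub_eq_zero.1 h]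
  have hint₁ : MeasureTheory.IntegrableOn (fun y => F y / (y - x)) (Set.Ioo (x - R) (x - ε)) :=
    ((hcont (Set.Icc (x - R) (x - ε)) (by simp [hε])).integrableOn_Icc).mono_set
      Set.Ioo_subset_Icc_self
  have hint₂ : MeasureTheory.IntegrableOn (fun y => F y / (y - x)) (Set.Ioo (x + ε) (x + R)) :=
    ((hcont (Set.Icc (x + ε) (x + R)) (by simp [hε])).integrableOn_Icc).mono_set
      Set.Ioo_subset_Icc_self
  have hsub : ∀ φ : ℝ → ℝ, Continuous φ →
      ∫ ρ in ε..R, φ ρ / ρ = ∫ s in Real.log ε..Real.log R, φ (Real.exp s) := by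
    intro φ hφ
    have h := intervalIntegral.integral_comp_mul_deriv'' (a := Real.log ε) (b := Real.log R)
      (f := Real.exp) (f' := Real.exp) (g := fun ρ => φ ρ / ρ)
      (by fun_prop) (fun s _ => (Real.hasDerivAt_exp s).hasDerivWithinAt) (by fun_prop)
      (hφ.continuousOn.div (by fun_prop) (by rintro _ ⟨s, _, rfl⟩; positivity))
    rw [Real.exp_log hε, Real.exp_log (hε.trans hR)] at h
    rw [← h]
    refine intervalIntegral.integral_congr fun s _ => ?_
    simp [Real.exp_ne_zero]
  rw [hset, MeasureTheory.setIntegral_union hdisj measurableSet_Ioo hint₁ hint₂,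
    ← MeasureTheory.integral_Ioc_eq_integral_Ioo, ← MeasureTheory.integral_Ioc_eq_integral_Ioo,
    ← intervalIntegral.integral_of_le (by linarith), ← intervalIntegral.integral_of_le (by linarith),
    intervalIntegral.integral_sub (Continuous.intervalIntegrable (by fun_prop) _ _)
      (Continuous.intervalIntegrable (by fun_prop) _ _),
    ← hsub (fun ρ => F (x + ρ)) (by fun_prop), ← hsub (fun ρ => F (x - ρ)) (by fun_prop),
    ← intervalIntegral.integral_comp_sub_left (fun y => F y / (y - x)) x,
    ← intervalIntegral.integral_comp_add_left (fun y => F y / (y - x)) x,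
    add_comm, sub_eq_add_neg, ← intervalIntegral.integral_neg]
  congr 1
  · simp
  · refine intervalIntegral.integral_congr fun ρ _ => ?_
    simp [div_neg]

/-- Cauchy's theorem on a half annulus, pulled back to a rectangle by the exponential. -/
theorem integral_sub_exp_eq_semicircles (G : ℂ → ℂ)
    (hG : ∀ z : ℂ, 0 ≤ z.im → DifferentiableAt ℂ G z) (x : ℝ) {ε R : ℝ}
    (hε : 0 < ε) (hR : 0 < R) :
    ∫ s in Real.log ε..Real.log R,
        (G ((x + Real.exp s : ℝ) : ℂ) - G ((x - Real.exp s : ℝ) : ℂ)) =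
      Complex.I * ((∫ θ in (0 : ℝ)..Real.pi, G (x + ε * Complex.exp (θ * Complex.I))) -
        ∫ θ in (0 : ℝ)..Real.pi, G (x + R * Complex.exp (θ * Complex.I))) := by
  have hcontR : Continuous fun y : ℝ => G y :=
    continuous_iff_continuousAt.2 fun y =>
      (hG y (by simp)).continuousAt.comp Complex.continuous_ofReal.continuousAt
  have h := Complex.integral_boundary_rect_eq_zero_of_differentiableOn
    (fun w => G (x + Complex.exp w)) (Real.log ε : ℂ) (Real.log R + Real.pi * Complex.I) (by
      intro w hw
      have him : w.im ∈ Set.Icc 0 Real.pi := by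
        have := hw.2
        simpa [Set.uIcc_of_le Real.pi_pos.le] using this
      refine ((hG _ ?_).comp w (by fun_prop)).differentiableWithinAt
      have := Real.sin_nonneg_of_mem_Icc him
      simp only [Complex.add_im, Complex.ofReal_im, Complex.exp_im, zero_add]
      positivity)
  simp only [Complex.ofReal_re, Complex.ofReal_im, Complex.add_re, Complex.add_im, Complex.mul_re,
    Complex.mul_im, Complex.I_re, Complex.I_im, mul_zero, mul_one, sub_zero, add_zero, zero_add,
    Complex.ofReal_zero, zero_mul, Complex.exp_add, Complex.exp_pi_mul_I, smul_eq_mul,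
    ← Complex.ofReal_exp, Real.exp_log hε, Real.exp_log hR] at h
  have hadd : Continuous fun s : ℝ => G ((x + Real.exp s : ℝ) : ℂ) :=
    hcontR.comp (by fun_prop : Continuous fun s => x + Real.exp s)
  have hsub : Continuous fun s : ℝ => G ((x - Real.exp s : ℝ) : ℂ) :=
    hcontR.comp (by fun_prop : Continuous fun s => x - Real.exp s)
  rw [intervalIntegral.integral_sub (hadd.intervalIntegrable _ _) (hsub.intervalIntegrable _ _)]
  have e : ∀ s : ℝ, ((x - Real.exp s : ℝ) : ℂ) = x + (Real.exp s : ℂ) * -1 := by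
    intro s; push_cast; ring
  simp only [e, Complex.ofReal_add]
  linear_combination h

/-- If `G` is holomorphic and bounded on the closed upper half-plane and tends to `0` as the
imaginary part grows, then its boundary values satisfy `H (Im G) = Re G`. -/
theorem hasHilbertTransform_im (G : ℂ → ℂ)
    (hG : ∀ z : ℂ, 0 ≤ z.im → DifferentiableAt ℂ G z)
    {C : ℝ} (hC : ∀ z : ℂ, 0 ≤ z.im → ‖G z‖ ≤ C)
    (h0 : Tendsto G (comap Complex.im atTop) (𝓝 0)) (x : ℝ) :
    HasHilbertTransform (fun y => (G y).im) x (G x).re := by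
  set Φ : ℝ → ℂ := fun ρ => ∫ θ in (0 : ℝ)..Real.pi, G (x + ρ * Complex.exp (θ * Complex.I))
  have him : ∀ ρ θ : ℝ, (x + ρ * Complex.exp (θ * Complex.I) : ℂ).im = ρ * Real.sin θ := by
    intro ρ θ
    simp [Complex.exp_ofReal_mul_I_im]
  have hcontR : Continuous fun y : ℝ => G y :=
    continuous_iff_continuousAt.2 fun y =>
      (hG y (by simp)).continuousAt.comp Complex.continuous_ofReal.continuousAt
  have hpos : ∀ ρ : ℝ, 0 < ρ → ∀ θ ∈ Set.uIoc 0 Real.pi,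
      0 ≤ (x + ρ * Complex.exp (θ * Complex.I) : ℂ).im := by
    intro ρ hρ θ hθ
    rw [Set.uIoc_of_le Real.pi_pos.le] at hθ
    rw [him]
    exact mul_nonneg hρ.le (Real.sin_nonneg_of_mem_Icc ⟨hθ.1.le, hθ.2⟩)
  have hmeas : ∀ ρ : ℝ, 0 < ρ → MeasureTheory.AEStronglyMeasurable
      (fun θ : ℝ => G (x + ρ * Complex.exp (θ * Complex.I)))
      (MeasureTheory.volume.restrict (Set.uIoc 0 Real.pi)) := by
    intro ρ hρ
    refine ContinuousOn.aestronglyMeasurable (fun θ hθ => ?_) measurableSet_uIoc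
    exact (ContinuousAt.comp (f := fun θ : ℝ => (x + ρ * Complex.exp (θ * Complex.I) : ℂ))
      (hG _ (hpos ρ hρ θ hθ)).continuousAt
      (by fun_prop)).continuousWithinAt
  have hsmall : Tendsto Φ (𝓝[>] 0) (𝓝 (Real.pi * G x)) := by
    have : (Real.pi * G x : ℂ) = ∫ _ in (0 : ℝ)..Real.pi, G x := by simp
    rw [this]
    refine intervalIntegral.tendsto_integral_filter_of_dominated_convergence (fun _ => C) ?_ ?_
      intervalIntegrable_const ?_
    · filter_upwards [self_mem_nhdsWithin] with ρ hρ using hmeas ρ hρ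
    · filter_upwards [self_mem_nhdsWithin] with ρ hρ
      exact Eventually.of_forall fun θ hθ => hC _ (hpos ρ hρ θ hθ)
    · refine Eventually.of_forall fun θ _ => ?_
      have h1 : Tendsto (fun ρ : ℝ => (x + ρ * Complex.exp (θ * Complex.I) : ℂ)) (𝓝[>] 0)
          (𝓝 x) := by
        have : Continuous fun ρ : ℝ => (x + ρ * Complex.exp (θ * Complex.I) : ℂ) := by fun_prop
        have h := (this.tendsto 0).mono_left (nhdsWithin_le_nhds (s := Set.Ioi 0))
        simpa using h
      exact (hG x (by simp)).continuousAt.tendsto.comp h1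
  have hlarge : Tendsto Φ atTop (𝓝 0) := by
    have : (0 : ℂ) = ∫ _ in (0 : ℝ)..Real.pi, (0 : ℂ) := by simp
    rw [this]
    refine intervalIntegral.tendsto_integral_filter_of_dominated_convergence (fun _ => C) ?_ ?_
      intervalIntegrable_const ?_
    · filter_upwards [eventually_gt_atTop 0] with ρ hρ using hmeas ρ hρ
    · filter_upwards [eventually_gt_atTop 0] with ρ hρ
      exact Eventually.of_forall fun θ hθ => hC _ (hpos ρ hρ θ hθ)
    · -- the endpoint `θ = π`, where the imaginary part does not grow, is negligible
      have hne : ∀ᵐ θ : ℝ, θ ≠ Real.pi := by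
        simp [MeasureTheory.ae_iff]
      filter_upwards [hne] with θ hθ hmem
      rw [Set.uIoc_of_le Real.pi_pos.le] at hmem
      refine h0.comp (tendsto_comap_iff.2 ?_)
      have hs : 0 < Real.sin θ :=
        Real.sin_pos_of_pos_of_lt_pi hmem.1 (lt_of_le_of_ne hmem.2 hθ)
      refine (tendsto_id.atTop_mul_const hs).congr fun ρ => ?_
      simp [him]
  have hlim : Tendsto (fun p : ℝ × ℝ => 1 / Real.pi * (Φ p.1 - Φ p.2).re)
      (𝓝[>] (0 : ℝ) ×ˢ atTop) (𝓝 (G x).re) := by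
    have h := (((hsmall.comp tendsto_fst).sub (hlarge.comp tendsto_snd)))
    have h' := ((Complex.continuous_re.tendsto _).comp h).const_mul (1 / Real.pi)
    have e : 1 / Real.pi * (Real.pi * G x - 0 : ℂ).re = (G x).re := by
      rw [sub_zero, Complex.re_ofReal_mul]
      field_simp
    rw [e] at h'
    exact h'
  refine hlim.congr' ?_
  have hev : ∀ᶠ p : ℝ × ℝ in 𝓝[>] (0 : ℝ) ×ˢ atTop, (0 < p.1 ∧ p.1 < 1) ∧ 1 < p.2 :=
    Eventually.prod_mk (Ioo_mem_nhdsGT one_pos) (eventually_gt_atTop 1)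
  filter_upwards [hev] with p hp
  obtain ⟨⟨hp0, hp1⟩, hp2⟩ := hp
  rw [setIntegral_annulus_div_sub (fun y => (G y).im) (Complex.continuous_im.comp hcontR) x hp0
    (hp1.trans hp2)]
  have h := integral_sub_exp_eq_semicircles G hG x hp0 (one_pos.trans hp2)
  have h' := congrArg Complex.im h
  rw [Complex.I_mul_im] at h'
  rw [← h', ← Complex.imCLM_apply, ← ContinuousLinearMap.intervalIntegral_comp_comm]
  · simp
  · exact ((hcontR.comp (by fun_prop : Continuous fun s => x + Real.exp s)).sub
      (hcontR.comp (by fun_prop : Continuous fun s => x - Real.exp s))).intervalIntegrable _ _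

/-! ### The two-phase tau function -/

/-- The two-phase tau function `1 + a r X + a Y + r X Y` in the exponentials `X`, `Y`. -/
def tau (a r : ℝ) (X Y : ℂ) : ℂ := 1 + a * r * X + a * Y + r * X * Y

/-- The derivative of `tau` when `X' = m₁ X` and `Y' = m₂ Y`. -/
def tauD (m₁ m₂ : ℂ) (a r : ℝ) (X Y : ℂ) : ℂ :=
  m₁ * (a * r * X) + m₂ * (a * Y) + (m₁ + m₂) * (r * X * Y)

/-- The second derivative of `tau` when `X' = m₁ X` and `Y' = m₂ Y`. -/
def tauDD (m₁ m₂ : ℂ) (a r : ℝ) (X Y : ℂ) : ℂ :=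
  m₁ ^ 2 * (a * r * X) + m₂ ^ 2 * (a * Y) + (m₁ + m₂) ^ 2 * (r * X * Y)

/-- The second logarithmic derivative of `tau` when `X' = m₁ X` and `Y' = m₂ Y`. -/
def logTauDD (m₁ m₂ : ℂ) (a r : ℝ) (X Y : ℂ) : ℂ :=
  (tauDD m₁ m₂ a r X Y * tau a r X Y - tauD m₁ m₂ a r X Y ^ 2) / tau a r X Y ^ 2

/-- The numerator `r X (a + α Y)` of the wave, without its amplitude. -/
def num (a r α : ℝ) (X Y : ℂ) : ℂ := a * r * X + α * r * X * Y

/-- The derivative of `num` when `X' = m₁ X` and `Y' = m₂ Y`. -/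
def numD (m₁ m₂ : ℂ) (a r α : ℝ) (X Y : ℂ) : ℂ :=
  m₁ * (a * r * X) + (m₁ + m₂) * (α * r * X * Y)

/-- The second derivative of `num` when `X' = m₁ X` and `Y' = m₂ Y`. -/
def numDD (m₁ m₂ : ℂ) (a r α : ℝ) (X Y : ℂ) : ℂ :=
  m₁ ^ 2 * (a * r * X) + (m₁ + m₂) ^ 2 * (α * r * X * Y)

section Derivatives

variable {𝕜 : Type*} [NontriviallyNormedField 𝕜] [NormedAlgebra 𝕜 ℂ] {m₁ m₂ : ℂ} {a r α : ℝ}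
  {X Y : 𝕜 → ℂ} {x : 𝕜}

theorem hasDerivAt_tau (hX : HasDerivAt X (m₁ * X x) x) (hY : HasDerivAt Y (m₂ * Y x) x) :
    HasDerivAt (fun y => tau a r (X y) (Y y)) (tauD m₁ m₂ a r (X x) (Y x)) x := by
  refine ((((hX.const_mul (a * r : ℂ)).const_add 1).add (hY.const_mul (a : ℂ))).add
    ((hX.const_mul (r : ℂ)).mul hY)).congr_deriv ?_
  simp only [tauD]
  ring

theorem hasDerivAt_tauD (hX : HasDerivAt X (m₁ * X x) x) (hY : HasDerivAt Y (m₂ * Y x) x) :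
    HasDerivAt (fun y => tauD m₁ m₂ a r (X y) (Y y)) (tauDD m₁ m₂ a r (X x) (Y x)) x := by
  refine ((((hX.const_mul (a * r : ℂ)).const_mul m₁).add
    ((hY.const_mul (a : ℂ)).const_mul m₂)).add
    (((hX.const_mul (r : ℂ)).mul hY).const_mul (m₁ + m₂))).congr_deriv ?_
  simp only [tauDD]
  ring

theorem hasDerivAt_num (hX : HasDerivAt X (m₁ * X x) x) (hY : HasDerivAt Y (m₂ * Y x) x) :
    HasDerivAt (fun y => num a r α (X y) (Y y)) (numD m₁ m₂ a r α (X x) (Y x)) x := by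
  refine ((hX.const_mul (a * r : ℂ)).add
    ((hX.const_mul (α * r : ℂ)).mul hY)).congr_deriv ?_
  simp only [numD]
  ring

theorem hasDerivAt_numD (hX : HasDerivAt X (m₁ * X x) x) (hY : HasDerivAt Y (m₂ * Y x) x) :
    HasDerivAt (fun y => numD m₁ m₂ a r α (X y) (Y y)) (numDD m₁ m₂ a r α (X x) (Y x)) x := by
  refine (((hX.const_mul (a * r : ℂ)).const_mul m₁).add
    (((hX.const_mul (α * r : ℂ)).mul hY).const_mul (m₁ + m₂))).congr_deriv ?_
  simp only [numDD]
  ring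

theorem hasDerivAt_logDeriv_tau (hX : HasDerivAt X (m₁ * X x) x)
    (hY : HasDerivAt Y (m₂ * Y x) x) (h : tau a r (X x) (Y x) ≠ 0) :
    HasDerivAt (fun y => tauD m₁ m₂ a r (X y) (Y y) / tau a r (X y) (Y y))
      (logTauDD m₁ m₂ a r (X x) (Y x)) x := by
  refine ((hasDerivAt_tauD hX hY).div (hasDerivAt_tau hX hY) h).congr_deriv ?_
  simp only [logTauDD]
  ring

end Derivatives

theorem deriv_deriv_div {N N' N'' T T' T'' : ℝ → ℂ} (hN : ∀ y, HasDerivAt N (N' y) y)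
    (hN' : ∀ y, HasDerivAt N' (N'' y) y) (hT : ∀ y, HasDerivAt T (T' y) y)
    (hT' : ∀ y, HasDerivAt T' (T'' y) y) (h0 : ∀ y, T y ≠ 0) (x : ℝ) :
    deriv (deriv fun y => N y / T y) x =
      (N'' x * T x ^ 2 - 2 * N' x * T' x * T x - N x * T'' x * T x + 2 * N x * T' x ^ 2)
        / T x ^ 3 := by
  have h1 : (deriv fun y => N y / T y) = fun y => (N' y * T y - N y * T' y) / T y ^ 2 := by
    ext y
    exact ((hN y).div (hT y) (h0 y)).deriv
  rw [h1]
  refine ((((hN' x).mul (hT x)).sub ((hN x).mul (hT' x))).div ((hT x).pow 2)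
    (pow_ne_zero 2 (h0 x))).deriv.trans ?_
  have := h0 x
  simp only [Pi.mul_apply, Pi.sub_apply, Pi.pow_apply]
  field_simp
  push_cast
  ring

section Zeros

variable {a r : ℝ} {X Y : ℂ}

theorem normSq_one_add_sub_normSq_add (a : ℝ) (Y : ℂ) :
    ‖1 + a * Y‖ ^ 2 - ‖a + Y‖ ^ 2 = (1 - a ^ 2) * (1 - ‖Y‖ ^ 2) := by
  simp only [← Complex.normSq_eq_norm_sq, Complex.normSq_apply]
  simp
  ring

/-- On the closed bidisc `|a + Y| ≤ |1 + a Y|`, so the part of `tau` carrying the factor `r < 1`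
cannot cancel the rest. -/
theorem tau_ne_zero (ha0 : 0 ≤ a) (ha : a < 1) (hr0 : 0 ≤ r) (hr : r < 1) (hX : ‖X‖ ≤ 1)
    (hY : ‖Y‖ ≤ 1) : tau a r X Y ≠ 0 := by
  intro h
  have h1 : 1 + a * Y = -(r * X * (a + Y)) := by
    simp only [tau] at h
    linear_combination h
  have h2 : ‖1 + a * Y‖ = r * ‖X‖ * ‖a + Y‖ := by
    rw [h1, norm_neg, norm_mul, norm_mul, Complex.norm_real, Real.norm_of_nonneg hr0]
  have h3 : ‖a + Y‖ ≤ ‖1 + a * Y‖ := by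
    have h4 := normSq_one_add_sub_normSq_add a Y
    have : 0 ≤ (1 - a ^ 2) * (1 - ‖Y‖ ^ 2) := by
      apply mul_nonneg <;> nlinarith [norm_nonneg Y]
    exact le_of_sq_le_sq (by linarith) (norm_nonneg _)
  have h5 : 1 - a ≤ ‖1 + a * Y‖ := by
    have h6 := norm_sub_norm_le (1 : ℂ) (-(a * Y))
    rw [sub_neg_eq_add, norm_neg, norm_mul, Complex.norm_real, Real.norm_of_nonneg ha0,
      norm_one] at h6
    nlinarith
  have h7 : r * ‖X‖ ≤ r := by nlinarith
  have h8 : r * ‖X‖ * ‖a + Y‖ ≤ r * ‖1 + a * Y‖ :=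
    mul_le_mul h7 h3 (norm_nonneg _) hr0
  nlinarith

theorem tau_ne_zero_of_norm_eq_one (ha0 : 0 ≤ a) (ha : a ≠ 1) (hr0 : 0 ≤ r) (hr : r < 1)
    (hX : ‖X‖ = 1) (hY : ‖Y‖ = 1) : tau a r X Y ≠ 0 := by
  intro h
  have h1 : 1 + a * Y = -(r * X * (a + Y)) := by
    simp only [tau] at h
    linear_combination h
  have h2 : ‖1 + a * Y‖ = r * ‖a + Y‖ := by
    rw [h1, norm_neg, norm_mul, norm_mul, Complex.norm_real, Real.norm_of_nonneg hr0, hX, mul_one]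
  have h3 := normSq_one_add_sub_normSq_add a Y
  rw [hY] at h3
  have h4 : ‖a + Y‖ = ‖1 + a * Y‖ := by
    rw [← sq_eq_sq₀ (norm_nonneg _) (norm_nonneg _)]
    linarith
  rw [h4] at h2
  have h5 : 1 + a * Y = 0 := by
    rw [← norm_eq_zero]
    nlinarith
  have h6 : ‖(a : ℂ) * Y‖ = 1 := by
    rw [(by linear_combination h5 : (a : ℂ) * Y = -1), norm_neg, norm_one]
  rw [norm_mul, Complex.norm_real, Real.norm_of_nonneg ha0, hY, mul_one] at h6
  exact ha h6

/-- The second logarithmic derivative of `tau` is bounded on the closed bidisc. -/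
theorem exists_norm_logTauDD_le (m₁ m₂ : ℂ) (ha0 : 0 ≤ a) (ha : a < 1) (hr0 : 0 ≤ r)
    (hr : r < 1) :
    ∃ C, ∀ X Y : ℂ, ‖X‖ ≤ 1 → ‖Y‖ ≤ 1 → ‖logTauDD m₁ m₂ a r X Y‖ ≤ C := by
  obtain ⟨C, hC⟩ := (isCompact_closedBall (0 : ℂ × ℂ) 1).exists_bound_of_continuousOn
    (f := fun q : ℂ × ℂ => logTauDD m₁ m₂ a r q.1 q.2) (by
      refine ContinuousOn.div ?_ ?_ fun q hq => pow_ne_zero 2 ?_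
      · simp only [tauDD, tauD, tau]
        fun_prop
      · simp only [tau]
        fun_prop
      · rw [mem_closedBall_zero_iff, Prod.norm_def, max_le_iff] at hq
        exact tau_ne_zero ha0 ha hr0 hr hq.1 hq.2)
  refine ⟨C, fun X Y hX hY => hC (X, Y) ?_⟩
  rw [mem_closedBall_zero_iff, Prod.norm_def]
  exact max_le hX hY

theorem tendsto_logTauDD_zero (m₁ m₂ : ℂ) (a r : ℝ) {ι : Type*} {l : Filter ι} {X Y : ι → ℂ}
    (hX : Tendsto X l (𝓝 0)) (hY : Tendsto Y l (𝓝 0)) :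
    Tendsto (fun i => logTauDD m₁ m₂ a r (X i) (Y i)) l (𝓝 0) := by
  have h : ContinuousAt (fun q : ℂ × ℂ => logTauDD m₁ m₂ a r q.1 q.2) (0, 0) := by
    refine ContinuousAt.div ?_ ?_ ?_
    · simp only [tauDD, tauD, tau]
      fun_prop
    · simp only [tau]
      fun_prop
    · simp [tau]
  have h' := h.tendsto.comp (hX.prodMk_nhds hY)
  simpa [logTauDD, tauDD, tauD, Function.comp_def] using h'

end Zeros

/-! ### Exponential phases -/

/-- The plane wave `exp (i κ (z - c t - s))`. -/
def phase (κ c s : ℝ) (z : ℂ) (t : ℝ) : ℂ := Complex.exp (Complex.I * κ * (z - c * t - s))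

section Phase

variable (κ c s : ℝ) (z : ℂ) (t : ℝ)

theorem phase_ne_zero : phase κ c s z t ≠ 0 := Complex.exp_ne_zero _

theorem norm_phase : ‖phase κ c s z t‖ = Real.exp (-(κ * z.im)) := by
  simp [phase, Complex.norm_exp]

theorem norm_phase_ofReal (x : ℝ) : ‖phase κ c s x t‖ = 1 := by simp [norm_phase]

theorem norm_phase_le_one {κ : ℝ} (hκ : 0 ≤ κ) {z : ℂ} (hz : 0 ≤ z.im) :
    ‖phase κ c s z t‖ ≤ 1 := by
  rw [norm_phase, Real.exp_le_one_iff, neg_nonpos]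
  positivity

theorem tendsto_phase {κ : ℝ} (hκ : 0 < κ) :
    Tendsto (fun z => phase κ c s z t) (comap Complex.im atTop) (𝓝 0) := by
  rw [tendsto_zero_iff_norm_tendsto_zero]
  simp only [norm_phase]
  exact Real.tendsto_exp_neg_atTop_nhds_zero.comp (tendsto_comap.const_mul_atTop hκ)

theorem phase_neg : phase (-κ) c s z t = (phase κ c s z t)⁻¹ := by
  rw [phase, phase, ← Complex.exp_neg]
  congr 1
  push_cast
  ring

theorem conj_phase_conj :
    (starRingEnd ℂ) (phase κ c s ((starRingEnd ℂ) z) t) = (phase κ c s z t)⁻¹ := by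
  rw [phase, phase, ← Complex.exp_neg, ← Complex.exp_conj]
  congr 1
  simp

theorem hasDerivAt_phase :
    HasDerivAt (fun w => phase κ c s w t) (Complex.I * κ * phase κ c s z t) z := by
  refine (((((hasDerivAt_id z).sub_const (c * t : ℂ)).sub_const (s : ℂ)).const_mul
    (Complex.I * κ)).cexp).congr_deriv ?_
  simp only [phase, id]
  ring

theorem hasDerivAt_phase_time :
    HasDerivAt (fun τ : ℝ => phase κ c s z τ) (-(Complex.I * (κ * c)) * phase κ c s z t) t := by
  have h : HasDerivAt (fun τ : ℝ => (τ : ℂ)) 1 t := Complex.ofRealCLM.hasDerivAt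
  refine (((((h.const_mul (c : ℂ)).const_sub z).sub_const (s : ℂ)).const_mul
    (Complex.I * κ)).cexp).congr_deriv ?_
  simp only [phase]
  ring

theorem contDiff_phase : ContDiff ℝ 2 fun q : ℝ × ℝ => phase κ c s q.1 q.2 := by
  have h1 : ContDiff ℝ 2 fun q : ℝ × ℝ => (q.1 : ℂ) := Complex.ofRealCLM.contDiff.comp contDiff_fst
  have h2 : ContDiff ℝ 2 fun q : ℝ × ℝ => (q.2 : ℂ) := Complex.ofRealCLM.contDiff.comp contDiff_snd
  unfold phase
  fun_prop

end Phase

/-! ### Bilinear identities -/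

section Algebra

variable {a r α : ℝ} {X Y : ℂ}

theorem conj_tau : (starRingEnd ℂ) (tau a r X Y) =
    tau a r ((starRingEnd ℂ) X) ((starRingEnd ℂ) Y) := by
  simp [tau]

/-- Inverting both exponentials exchanges the tau functions with `r` and `r⁻¹`. -/
theorem tau_inv_mul (hr : r ≠ 0) (hX : X ≠ 0) (hY : Y ≠ 0) :
    tau a r X⁻¹ Y⁻¹ * (X * Y) = r * tau a r⁻¹ X Y := by
  have : (r : ℂ) ≠ 0 := by exact_mod_cast hr
  simp only [tau, Complex.ofReal_inv]
  field_simp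
  ring

theorem tauD_inv_mul (m₁ m₂ : ℂ) (hr : r ≠ 0) (hX : X ≠ 0) (hY : Y ≠ 0) :
    tauD (-m₁) (-m₂) a r X⁻¹ Y⁻¹ * (X * Y) =
      r * (tauD m₁ m₂ a r⁻¹ X Y - (m₁ + m₂) * tau a r⁻¹ X Y) := by
  have : (r : ℂ) ≠ 0 := by exact_mod_cast hr
  simp only [tau, tauD, Complex.ofReal_inv]
  field_simp
  ring

/-- The bilinear equation, divided by `T ^ 2`, is the evolution equation for `γ N / T` with the
nonlinearity `2 (ln T)''`. -/
theorem evolution_of_bilinear {γ N Nt N₁ N₂ T Tt T₁ T₂ : ℂ} (hT : T ≠ 0)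
    (h : Complex.I * (Nt * T - N * Tt) = N₂ * T - 2 * N₁ * T₁ + N * T₂) :
    Complex.I * ((γ * Nt * T - γ * N * Tt) / T ^ 2) =
      (γ * N₂ * T ^ 2 - 2 * (γ * N₁) * T₁ * T - γ * N * T₂ * T + 2 * (γ * N) * T₁ ^ 2) / T ^ 3 +
        ((-1 : ℝ) : ℂ) * (γ * N / T) * (-2 * ((T₂ * T - T₁ ^ 2) / T ^ 2)) := by
  push_cast
  field_simp
  linear_combination γ * T * h

theorem conj_num_mul (hX : X ≠ 0) (hY : Y ≠ 0) :
    num a r α X⁻¹ Y⁻¹ * (X * Y) = r * (a * Y + α) := by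
  simp only [num]
  field_simp

end Algebra

/-! ### Admissible constants -/

/-- The relations between the constants on which the bilinear equations rest, for
`a = exp (-A / 2)`. -/
structure Params.IsAdmissible (p : Params) (A γ : ℝ) : Prop where
  k₁_pos : 0 < p.k₁
  φ₁_pos : 0 < p.φ₁
  α₂_ne_zero : p.α₂ ≠ 0
  /-- The coefficient of `X Y` in the evolution equation. -/
  coeff_XY : Real.exp (-A / 2) ^ 2 * (p.k₂ ^ 2 - p.k₂ * p.c₂ - 2 * p.k₁ * p.k₂) +
    p.α₂ * (p.k₂ ^ 2 + p.k₂ * p.c₂ + 2 * p.k₁ * p.k₂) = 0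
  /-- The coefficient of `X² Y` in the evolution equation. -/
  coeff_XXY : p.α₂ * (p.c₂ + p.k₂) = p.c₂ - p.k₂
  /-- The extreme coefficients in the equation for `|u|²`. -/
  gamma_sq : γ ^ 2 * p.α₂ = p.k₁ * (Real.exp p.φ₁ ^ 2 - 1)
  /-- The middle coefficient in the equation for `|u|²`. -/
  coeff_mid : p.k₁ * (Real.exp (-A / 2) ^ 2 + p.α₂ ^ 2) =
    p.α₂ * (p.k₁ * (1 + Real.exp (-A / 2) ^ 2) + p.k₂ * (1 - Real.exp (-A / 2) ^ 2))
  exp_ne_one : Real.exp (-A / 2) ≠ 1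

/-! ### The two-phase wave -/

namespace Params

variable (p : Params) (A γ : ℝ)

/-- The exponential `exp (i k₁ ξ₁)`. -/
def X (z : ℂ) (t : ℝ) : ℂ := phase p.k₁ p.c₁ p.x₁ z t

/-- The exponential `exp (i k₂ ξ₂)`. -/
def Y (z : ℂ) (t : ℝ) : ℂ := phase p.k₂ p.c₂ p.x₂ z t

theorem X_ne_zero (z : ℂ) (t : ℝ) : p.X z t ≠ 0 := phase_ne_zero _ _ _ z t

theorem Y_ne_zero (z : ℂ) (t : ℝ) : p.Y z t ≠ 0 := phase_ne_zero _ _ _ z t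

theorem conj_X_conj (z : ℂ) (t : ℝ) :
    (starRingEnd ℂ) (p.X ((starRingEnd ℂ) z) t) = (p.X z t)⁻¹ := conj_phase_conj _ _ _ z t

theorem conj_Y_conj (z : ℂ) (t : ℝ) :
    (starRingEnd ℂ) (p.Y ((starRingEnd ℂ) z) t) = (p.Y z t)⁻¹ := conj_phase_conj _ _ _ z t

theorem conj_X_ofReal (x t : ℝ) : (starRingEnd ℂ) (p.X x t) = (p.X x t)⁻¹ := by
  simpa using p.conj_X_conj x t

theorem conj_Y_ofReal (x t : ℝ) : (starRingEnd ℂ) (p.Y x t) = (p.Y x t)⁻¹ := by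
  simpa using p.conj_Y_conj x t

theorem f_eq_tau (z : ℂ) (t : ℝ) :
    p.f A z t = tau (Real.exp (-A / 2)) (Real.exp p.φ₁)⁻¹ (p.X z t) (p.Y z t) := by
  simp only [f, tau, X, Y, phase, ξ₁, ξ₂, ← Real.exp_neg, Complex.ofReal_exp, ← Complex.exp_add]
  push_cast
  ring_nf

theorem fTilde_eq_tau (z : ℂ) (t : ℝ) :
    p.fTilde A z t = tau (Real.exp (-A / 2)) (Real.exp p.φ₁) (p.X z t) (p.Y z t) := by
  simp only [fTilde, tau, X, Y, phase, ξ₁, ξ₂, Complex.ofReal_exp, ← Complex.exp_add]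
  push_cast
  ring_nf

theorem g_eq_num (z : ℂ) (t : ℝ) :
    p.g A γ z t =
      γ * num (Real.exp (-A / 2)) (Real.exp p.φ₁)⁻¹ p.α₂ (p.X z t) (p.Y z t) := by
  simp only [g, num, X, Y, phase, ξ₁, ξ₂, ← Real.exp_neg, Complex.ofReal_exp, ← Complex.exp_add,
    mul_assoc]
  push_cast
  ring_nf

theorem gTilde_eq (z : ℂ) (t : ℝ) :
    p.gTilde A γ z t = γ * (Real.exp (-A / 2) * p.Y z t + p.α₂) := by
  simp only [gTilde, Y, phase, ξ₂, Complex.ofReal_exp, ← Complex.exp_add]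
  push_cast
  ring_nf

theorem conj_f_conj_mul (z : ℂ) (t : ℝ) :
    (starRingEnd ℂ) (p.f A ((starRingEnd ℂ) z) t) * (p.X z t * p.Y z t) =
      ((Real.exp p.φ₁)⁻¹ : ℝ) * p.fTilde A z t := by
  rw [f_eq_tau, fTilde_eq_tau, conj_tau, conj_X_conj, conj_Y_conj,
    tau_inv_mul (inv_ne_zero (Real.exp_ne_zero _)) (p.X_ne_zero z t) (p.Y_ne_zero z t), inv_inv]

theorem fTilde_eq_zero_iff (z : ℂ) (t : ℝ) :
    p.fTilde A z t = 0 ↔ p.f A ((starRingEnd ℂ) z) t = 0 := by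
  have h := p.conj_f_conj_mul A z t
  have hr : (((Real.exp p.φ₁)⁻¹ : ℝ) : ℂ) ≠ 0 := by
    exact_mod_cast inv_ne_zero (Real.exp_ne_zero _)
  have hXY : p.X z t * p.Y z t ≠ 0 := mul_ne_zero (p.X_ne_zero z t) (p.Y_ne_zero z t)
  constructor <;> intro h0
  · rw [h0, mul_zero] at h
    exact (map_eq_zero _).1 ((mul_eq_zero.1 h).resolve_right hXY)
  · rw [h0, map_zero, zero_mul] at h
    exact (mul_eq_zero.1 h.symm).resolve_left hr

theorem hasDerivAt_X (x t : ℝ) :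
    HasDerivAt (fun y : ℝ => p.X y t) (Complex.I * p.k₁ * p.X x t) x :=
  (hasDerivAt_phase p.k₁ p.c₁ p.x₁ x t).comp_ofReal

theorem hasDerivAt_Y (x t : ℝ) :
    HasDerivAt (fun y : ℝ => p.Y y t) (Complex.I * p.k₂ * p.Y x t) x :=
  (hasDerivAt_phase p.k₂ p.c₂ p.x₂ x t).comp_ofReal

variable {p A γ}

theorem IsAdmissible.exp_inv_lt_one (h : p.IsAdmissible A γ) : (Real.exp p.φ₁)⁻¹ < 1 :=
  inv_lt_one_of_one_lt₀ (Real.one_lt_exp_iff.2 h.φ₁_pos)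

theorem IsAdmissible.f_ne_zero (h : p.IsAdmissible A γ) (x t : ℝ) : p.f A x t ≠ 0 := by
  rw [f_eq_tau]
  exact tau_ne_zero_of_norm_eq_one (Real.exp_pos _).le h.exp_ne_one
    (inv_nonneg.2 (Real.exp_pos _).le) h.exp_inv_lt_one (norm_phase_ofReal ..)
    (norm_phase_ofReal ..)

theorem IsAdmissible.fTilde_ne_zero (h : p.IsAdmissible A γ) (x t : ℝ) :
    p.fTilde A x t ≠ 0 := by
  rw [Ne, fTilde_eq_zero_iff, Complex.conj_ofReal]
  exact h.f_ne_zero x t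

theorem conj_u (x t : ℝ) :
    (starRingEnd ℂ) (p.u A γ x t) = p.gTilde A γ x t / p.fTilde A x t := by
  have hXY : p.X x t * p.Y x t ≠ 0 := mul_ne_zero (p.X_ne_zero x t) (p.Y_ne_zero x t)
  have hf := p.conj_f_conj_mul A x t
  have hr : (((Real.exp p.φ₁)⁻¹ : ℝ) : ℂ) ≠ 0 := by
    exact_mod_cast inv_ne_zero (Real.exp_ne_zero _)
  have hg : (starRingEnd ℂ) (p.g A γ x t) * (p.X x t * p.Y x t) =
      ((Real.exp p.φ₁)⁻¹ : ℝ) * p.gTilde A γ x t := by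
    have := conj_num_mul (a := Real.exp (-A / 2)) (α := p.α₂)
      (r := (Real.exp p.φ₁)⁻¹) (p.X_ne_zero x t) (p.Y_ne_zero x t)
    rw [g_eq_num, gTilde_eq, map_mul, Complex.conj_ofReal, mul_left_comm _ (γ : ℂ), ← this]
    simp only [num, map_add, map_mul, Complex.conj_ofReal, conj_X_ofReal, conj_Y_ofReal]
    ring
  rw [Complex.conj_ofReal] at hf
  rw [u, map_div₀, ← mul_div_mul_right _ _ hXY, hg, hf, mul_div_mul_left _ _ hr]

/-- The identity `|u|² = i (ln f - ln f̃)'`, with the derivatives of `f` and `f̃` written out. -/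
theorem IsAdmissible.normSq_u (h : p.IsAdmissible A γ) (x t : ℝ) :
    ((‖p.u A γ x t‖ ^ 2 : ℝ) : ℂ) = Complex.I *
      (tauD (Complex.I * p.k₁) (Complex.I * p.k₂) (Real.exp (-A / 2)) (Real.exp p.φ₁)⁻¹
          (p.X x t) (p.Y x t) / p.f A x t -
        tauD (Complex.I * p.k₁) (Complex.I * p.k₂) (Real.exp (-A / 2)) (Real.exp p.φ₁)
          (p.X x t) (p.Y x t) / p.fTilde A x t) := by
  have hf := h.f_ne_zero x t
  have hf' := h.fTilde_ne_zero x t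
  have hc : ((‖p.u A γ x t‖ ^ 2 : ℝ) : ℂ) =
      p.u A γ x t * (starRingEnd ℂ) (p.u A γ x t) := by
    rw [Complex.mul_conj, Complex.normSq_eq_norm_sq]
  have hγ : (γ : ℂ) ^ 2 * p.α₂ = p.k₁ * ((Real.exp p.φ₁ : ℂ) ^ 2 - 1) := by
    exact_mod_cast h.gamma_sq
  have hmid : (p.k₁ : ℂ) * ((Real.exp (-A / 2) : ℂ) ^ 2 + p.α₂ ^ 2) =
      p.α₂ * (p.k₁ * (1 + (Real.exp (-A / 2) : ℂ) ^ 2) +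
        p.k₂ * (1 - (Real.exp (-A / 2) : ℂ) ^ 2)) := by
    exact_mod_cast h.coeff_mid
  have hα : (p.α₂ : ℂ) ≠ 0 := by exact_mod_cast h.α₂_ne_zero
  have hR : (Real.exp p.φ₁ : ℂ) ≠ 0 := by exact_mod_cast Real.exp_ne_zero _
  rw [hc, conj_u, u, div_mul_div_comm, div_sub_div _ _ hf hf', ← mul_div_assoc]
  congr 1
  rw [f_eq_tau, fTilde_eq_tau, g_eq_num, gTilde_eq]
  generalize p.X x t = X, p.Y x t = Y
  generalize Real.exp (-A / 2) = a at *
  generalize Real.exp p.φ₁ = R at *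
  simp only [tau, tauD, num, Complex.ofReal_inv]
  field_simp
  simp only [Complex.I_sq]
  refine mul_left_cancel₀ hα ?_
  linear_combination ((a + p.α₂ * Y) * (a * Y + p.α₂)) * X * hγ + (R ^ 2 - 1) * X * Y * hmid

theorem IsAdmissible.hasBilinearRepresentation (h : p.IsAdmissible A γ) :
    HasBilinearRepresentation (p.u A γ) (p.f A) (p.fTilde A) (p.g A γ) (p.gTilde A γ) := by
  intro x t
  have hf := h.f_ne_zero x t
  have hf' := h.fTilde_ne_zero x t
  refine ⟨hf, hf', rfl, conj_u x t, ?_⟩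
  rw [h.normSq_u]
  have d := hasDerivAt_tau (a := Real.exp (-A / 2)) (r := (Real.exp p.φ₁)⁻¹)
    (p.hasDerivAt_X x t) (p.hasDerivAt_Y x t)
  have d' := hasDerivAt_tau (a := Real.exp (-A / 2)) (r := Real.exp p.φ₁)
    (p.hasDerivAt_X x t) (p.hasDerivAt_Y x t)
  simp only [← f_eq_tau] at d
  simp only [← fTilde_eq_tau] at d'
  rw [logDeriv_div x hf hf' d.differentiableAt d'.differentiableAt, logDeriv_apply,
    logDeriv_apply, d.deriv, d'.deriv]

/-- Since `f̃ = r⁻¹ X Y conj f` on the real line, the two terms of `i (ln f - ln f̃)'` are complex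
conjugate up to the constant `k₁ + k₂`. -/
theorem IsAdmissible.normSq_u_eq_im (h : p.IsAdmissible A γ) (x t : ℝ) :
    ‖p.u A γ x t‖ ^ 2 = -2 * (tauD (Complex.I * p.k₁) (Complex.I * p.k₂) (Real.exp (-A / 2))
      (Real.exp p.φ₁)⁻¹ (p.X x t) (p.Y x t) / tau (Real.exp (-A / 2)) (Real.exp p.φ₁)⁻¹
        (p.X x t) (p.Y x t)).im + (p.k₁ + p.k₂) := by
  have hN := h.normSq_u x t
  have hf := h.f_ne_zero x t
  have hf' := h.fTilde_ne_zero x t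
  have hX := p.conj_X_ofReal x t
  have hY := p.conj_Y_ofReal x t
  have hX0 := p.X_ne_zero x t
  have hY0 := p.Y_ne_zero x t
  have hr : (Real.exp p.φ₁)⁻¹ ≠ 0 := inv_ne_zero (Real.exp_ne_zero _)
  have hrc : (((Real.exp p.φ₁)⁻¹ : ℝ) : ℂ) ≠ 0 := by exact_mod_cast hr
  rw [f_eq_tau] at hN hf
  rw [fTilde_eq_tau] at hN hf'
  have e1 := tau_inv_mul (a := Real.exp (-A / 2)) hr hX0 hY0
  have e2 := tauD_inv_mul (a := Real.exp (-A / 2)) (Complex.I * p.k₁) (Complex.I * p.k₂)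
    hr hX0 hY0
  rw [inv_inv] at e1 e2
  set L := tauD (Complex.I * p.k₁) (Complex.I * p.k₂) (Real.exp (-A / 2))
      (Real.exp p.φ₁)⁻¹ (p.X x t) (p.Y x t) / tau (Real.exp (-A / 2)) (Real.exp p.φ₁)⁻¹
        (p.X x t) (p.Y x t) with hL
  have hconj : (starRingEnd ℂ) L = tauD (Complex.I * p.k₁) (Complex.I * p.k₂)
      (Real.exp (-A / 2)) (Real.exp p.φ₁) (p.X x t) (p.Y x t) /
      tau (Real.exp (-A / 2)) (Real.exp p.φ₁) (p.X x t) (p.Y x t) -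
        (Complex.I * p.k₁ + Complex.I * p.k₂) := by
    have e3 : (starRingEnd ℂ) (tauD (Complex.I * p.k₁) (Complex.I * p.k₂) (Real.exp (-A / 2))
      (Real.exp p.φ₁)⁻¹ (p.X x t) (p.Y x t)) = tauD (-(Complex.I * p.k₁)) (-(Complex.I * p.k₂))
        (Real.exp (-A / 2)) (Real.exp p.φ₁)⁻¹ (p.X x t)⁻¹ (p.Y x t)⁻¹ := by
      simp only [tauD, map_add, map_mul, Complex.conj_ofReal, Complex.conj_I, hX, hY, neg_mul]
    rw [hL, map_div₀, conj_tau, hX, hY, e3, ← mul_div_mul_right _ _ (mul_ne_zero hX0 hY0), e1, e2,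
      mul_div_mul_left _ _ hrc, sub_div, mul_div_cancel_right₀ _ hf']
  rw [eq_sub_iff_add_eq] at hconj
  rw [← hconj] at hN
  have := congrArg Complex.re hN
  simp only [Complex.ofReal_re, Complex.mul_re, Complex.I_re, Complex.I_im, Complex.sub_im,
    Complex.add_im, Complex.conj_im, Complex.mul_im, Complex.ofReal_im] at this
  linarith

theorem IsAdmissible.hasDerivAt_normSq_u (h : p.IsAdmissible A γ) (x t : ℝ) :
    HasDerivAt (fun y : ℝ => ‖p.u A γ y t‖ ^ 2)
      (-2 * (logTauDD (Complex.I * p.k₁) (Complex.I * p.k₂) (Real.exp (-A / 2))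
        (Real.exp p.φ₁)⁻¹ (p.X x t) (p.Y x t)).im) x := by
  simp only [h.normSq_u_eq_im]
  have hf := h.f_ne_zero x t
  rw [f_eq_tau] at hf
  have hd := hasDerivAt_logDeriv_tau (p.hasDerivAt_X x t) (p.hasDerivAt_Y x t) hf
  exact ((Complex.imCLM.hasFDerivAt.comp_hasDerivAt x hd).const_mul (-2)).add_const _

theorem IsAdmissible.contDiff_u (h : p.IsAdmissible A γ) :
    ContDiff ℝ 2 fun q : ℝ × ℝ => p.u A γ q.1 q.2 := by
  have hX : ContDiff ℝ 2 fun q : ℝ × ℝ => p.X q.1 q.2 := contDiff_phase p.k₁ p.c₁ p.x₁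
  have hY : ContDiff ℝ 2 fun q : ℝ × ℝ => p.Y q.1 q.2 := contDiff_phase p.k₂ p.c₂ p.x₂
  have hg : ContDiff ℝ 2 fun q : ℝ × ℝ => p.g A γ q.1 q.2 := by
    simp only [g_eq_num, num]
    fun_prop
  have hf : ContDiff ℝ 2 fun q : ℝ × ℝ => p.f A q.1 q.2 := by
    simp only [f_eq_tau, tau]
    fun_prop
  have h0 : ∀ q : ℝ × ℝ, p.f A q.1 q.2 ≠ 0 := fun q => h.f_ne_zero q.1 q.2
  simp only [u, div_eq_mul_inv]
  exact hg.mul (hf.inv h0)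

theorem IsAdmissible.isTwoPeriodicWave (h : p.IsAdmissible A γ) :
    IsTwoPeriodicWave p.k₁ p.k₂ p.c₁ p.c₂ (p.u A γ) := by
  set X : ℝ → ℂ := fun b => Complex.exp ((b - p.k₁ * p.x₁ : ℝ) * Complex.I) with hX
  set Y : ℝ → ℂ := fun b => Complex.exp ((b - p.k₂ * p.x₂ : ℝ) * Complex.I) with hY
  have hX2 : ∀ b, X (b + 2 * Real.pi) = X b := fun b => by
    simp only [hX]
    rw [Complex.exp_eq_exp_iff_exists_int]
    exact ⟨1, by push_cast; ring⟩
  have hY2 : ∀ b, Y (b + 2 * Real.pi) = Y b := fun b => by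
    simp only [hY]
    rw [Complex.exp_eq_exp_iff_exists_int]
    exact ⟨1, by push_cast; ring⟩
  refine ⟨fun b₁ b₂ => γ * num (Real.exp (-A / 2)) (Real.exp p.φ₁)⁻¹ p.α₂ (X b₁) (Y b₂) /
    tau (Real.exp (-A / 2)) (Real.exp p.φ₁)⁻¹ (X b₁) (Y b₂), ?_, ?_, ?_, ?_⟩
  · refine Continuous.div ?_ ?_ fun q => tau_ne_zero_of_norm_eq_one (Real.exp_pos _).le
      h.exp_ne_one (inv_nonneg.2 (Real.exp_pos _).le) h.exp_inv_lt_one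
      (Complex.norm_exp_ofReal_mul_I _) (Complex.norm_exp_ofReal_mul_I _)
    · simp only [num, hX, hY]
      fun_prop
    · simp only [tau, hX, hY]
      fun_prop
  · intro b₁ b₂
    simp only [hX2]
  · intro b₁ b₂
    simp only [hY2]
  · intro x t
    have e₁ : p.X x t = X (p.k₁ * (x - p.c₁ * t)) := by
      simp only [Params.X, phase, hX]
      push_cast
      ring_nf
    have e₂ : p.Y x t = Y (p.k₂ * (x - p.c₂ * t)) := by
      simp only [Params.Y, phase, hY]
      push_cast
      ring_nf
    rw [u, f_eq_tau, g_eq_num, e₁, e₂]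

/-- The bilinear equation `i (gₜ f - g fₜ) = gₓₓ f - 2 gₓ fₓ + g fₓₓ`. -/
theorem IsAdmissible.bilinear_evolution (h : p.IsAdmissible A γ) (r : ℝ) (X Y : ℂ) :
    Complex.I * (numD (-(Complex.I * (p.k₁ * p.c₁))) (-(Complex.I * (p.k₂ * p.c₂)))
          (Real.exp (-A / 2)) r p.α₂ X Y * tau (Real.exp (-A / 2)) r X Y -
        num (Real.exp (-A / 2)) r p.α₂ X Y * tauD (-(Complex.I * (p.k₁ * p.c₁)))
          (-(Complex.I * (p.k₂ * p.c₂))) (Real.exp (-A / 2)) r X Y) =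
      numDD (Complex.I * p.k₁) (Complex.I * p.k₂) (Real.exp (-A / 2)) r p.α₂ X Y *
          tau (Real.exp (-A / 2)) r X Y -
        2 * numD (Complex.I * p.k₁) (Complex.I * p.k₂) (Real.exp (-A / 2)) r p.α₂ X Y *
          tauD (Complex.I * p.k₁) (Complex.I * p.k₂) (Real.exp (-A / 2)) r X Y +
        num (Real.exp (-A / 2)) r p.α₂ X Y *
          tauDD (Complex.I * p.k₁) (Complex.I * p.k₂) (Real.exp (-A / 2)) r X Y := by
  have h1 : (Real.exp (-A / 2) : ℂ) ^ 2 * (p.k₂ ^ 2 - p.k₂ * p.c₂ - 2 * p.k₁ * p.k₂) +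
      p.α₂ * (p.k₂ ^ 2 + p.k₂ * p.c₂ + 2 * p.k₁ * p.k₂) = 0 := by
    exact_mod_cast h.coeff_XY
  have h2 : (p.α₂ : ℂ) * (p.c₂ + p.k₂) = p.c₂ - p.k₂ := by exact_mod_cast h.coeff_XXY
  have h3 : (p.c₁ : ℂ) = -p.k₁ := by simp [c₁]
  rw [h3]
  simp only [num, numD, numDD, tau, tauD, tauDD]
  generalize Real.exp (-A / 2) = a at *
  linear_combination (-Complex.I ^ 2 * r * X * Y) * h1 -
    (Complex.I ^ 2 * a * r ^ 2 * X ^ 2 * Y * p.k₂) * h2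

theorem IsAdmissible.tau_ne_zero_of_im_nonneg (h : p.IsAdmissible A γ) (hk₂ : 0 < p.k₂)
    (hA : Real.exp (-A / 2) < 1) {z : ℂ} (hz : 0 ≤ z.im) (t : ℝ) :
    tau (Real.exp (-A / 2)) (Real.exp p.φ₁)⁻¹ (p.X z t) (p.Y z t) ≠ 0 :=
  tau_ne_zero (Real.exp_pos _).le hA (inv_nonneg.2 (Real.exp_pos _).le) h.exp_inv_lt_one
    (norm_phase_le_one _ _ _ h.k₁_pos.le hz) (norm_phase_le_one _ _ _ hk₂.le hz)

theorem IsAdmissible.im_neg_of_f_eq_zero (h : p.IsAdmissible A γ) (hk₂ : 0 < p.k₂)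
    (hA : Real.exp (-A / 2) < 1) {z : ℂ} {t : ℝ} (hz : p.f A z t = 0) : z.im < 0 := by
  by_contra! hn
  rw [f_eq_tau] at hz
  exact h.tau_ne_zero_of_im_nonneg hk₂ hA hn t hz

theorem IsAdmissible.hasHilbertTransform (h : p.IsAdmissible A γ) (hk₂ : 0 < p.k₂)
    (hA : Real.exp (-A / 2) < 1) (x t : ℝ) :
    HasHilbertTransform (deriv fun y : ℝ => ‖p.u A γ y t‖ ^ 2) x
      (-2 * (logTauDD (Complex.I * p.k₁) (Complex.I * p.k₂) (Real.exp (-A / 2))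
        (Real.exp p.φ₁)⁻¹ (p.X x t) (p.Y x t)).re) := by
  have hd : (deriv fun y : ℝ => ‖p.u A γ y t‖ ^ 2) = fun y : ℝ =>
      -2 * (logTauDD (Complex.I * p.k₁) (Complex.I * p.k₂) (Real.exp (-A / 2))
        (Real.exp p.φ₁)⁻¹ (p.X y t) (p.Y y t)).im :=
    funext fun y => (h.hasDerivAt_normSq_u y t).deriv
  obtain ⟨C, hC⟩ := exists_norm_logTauDD_le (Complex.I * p.k₁) (Complex.I * p.k₂)
    (Real.exp_pos _).le hA (inv_nonneg.2 (Real.exp_pos p.φ₁).le) h.exp_inv_lt_one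
  have hH := hasHilbertTransform_im
    (fun z => logTauDD (Complex.I * p.k₁) (Complex.I * p.k₂) (Real.exp (-A / 2))
        (Real.exp p.φ₁)⁻¹ (p.X z t) (p.Y z t)) (by
      intro z hz
      have hX : DifferentiableAt ℂ (fun w => p.X w t) z :=
        (hasDerivAt_phase ..).differentiableAt
      have hY : DifferentiableAt ℂ (fun w => p.Y w t) z :=
        (hasDerivAt_phase ..).differentiableAt
      refine DifferentiableAt.div ?_ ?_
        (pow_ne_zero 2 (h.tau_ne_zero_of_im_nonneg hk₂ hA hz t))
      · simp only [tauDD, tauD, tau]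
        fun_prop
      · simp only [tau]
        fun_prop)
    (fun z hz => hC _ _ (norm_phase_le_one _ _ _ h.k₁_pos.le hz)
      (norm_phase_le_one _ _ _ hk₂.le hz))
    (tendsto_logTauDD_zero _ _ _ _ (tendsto_phase _ _ _ h.k₁_pos) (tendsto_phase _ _ _ hk₂)) x
  rw [hd]
  refine (hH.const_mul (-2)).congr fun q => ?_
  rw [mul_left_comm, ← MeasureTheory.integral_const_mul]
  simp only [mul_div_assoc]

/-- With `G = (ln f)''` one has `(|u|²)ₓ = -2 Im G` and `H (|u|²)ₓ = -2 Re G`, hence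
`(i + H) (|u|²)ₓ = -2 G`, and the equation is the bilinear one divided by `f ^ 2`. -/
theorem IsAdmissible.isClassicalSolution_of_pos (h : p.IsAdmissible A γ) (hk₂ : 0 < p.k₂)
    (hA : Real.exp (-A / 2) < 1) : IsClassicalSolution (-1) (p.u A γ) := by
  refine ⟨h.contDiff_u, fun x t => ⟨_, h.hasHilbertTransform hk₂ hA x t, ?_⟩⟩
  have hT : ∀ y s : ℝ, tau (Real.exp (-A / 2)) (Real.exp p.φ₁)⁻¹ (p.X y s) (p.Y y s) ≠ 0 := by
    intro y s
    rw [← f_eq_tau]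
    exact h.f_ne_zero y s
  have hXt : HasDerivAt (fun s : ℝ => p.X x s) (-(Complex.I * (p.k₁ * p.c₁)) * p.X x t) t :=
    hasDerivAt_phase_time ..
  have hYt : HasDerivAt (fun s : ℝ => p.Y x s) (-(Complex.I * (p.k₂ * p.c₂)) * p.Y x t) t :=
    hasDerivAt_phase_time ..
  have ht := (((hasDerivAt_num (a := Real.exp (-A / 2)) (r := (Real.exp p.φ₁)⁻¹)
    (α := p.α₂) hXt hYt).const_mul (γ : ℂ)).div
    (hasDerivAt_tau hXt hYt) (hT x t)).deriv
  have hxx := deriv_deriv_div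
    (fun y => (hasDerivAt_num (a := Real.exp (-A / 2)) (r := (Real.exp p.φ₁)⁻¹) (α := p.α₂)
      (p.hasDerivAt_X y t) (p.hasDerivAt_Y y t)).const_mul (γ : ℂ))
    (fun y => (hasDerivAt_numD (p.hasDerivAt_X y t) (p.hasDerivAt_Y y t)).const_mul (γ : ℂ))
    (fun y => hasDerivAt_tau (p.hasDerivAt_X y t) (p.hasDerivAt_Y y t))
    (fun y => hasDerivAt_tauD (p.hasDerivAt_X y t) (p.hasDerivAt_Y y t)) (fun y => hT y t) x
  have hnl : ∀ G : ℂ, Complex.I * ((-2 * G.im : ℝ) : ℂ) + ((-2 * G.re : ℝ) : ℂ) = -2 * G := by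
    intro G
    conv_rhs => rw [← Complex.re_add_im G]
    push_cast
    ring
  rw [(h.hasDerivAt_normSq_u x t).deriv, hnl]
  simp only [u, f_eq_tau, g_eq_num, logTauDD]
  rw [hxx]
  refine (congrArg (Complex.I * ·) ht).trans ?_
  exact evolution_of_bilinear (hT x t) (h.bilinear_evolution (Real.exp p.φ₁)⁻¹ (p.X x t) (p.Y x t))

/-! ### Reflection in the second wave number -/

variable (p)

/-- The parameters with the sign of `k₂` reversed. -/
def reflect : Params := { p with k₂ := -p.k₂ }

theorem X_reflect (z : ℂ) (t : ℝ) : p.reflect.X z t = p.X z t := rfl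

theorem Y_reflect (z : ℂ) (t : ℝ) : p.reflect.Y z t = (p.Y z t)⁻¹ := phase_neg ..

theorem α₂_reflect : p.reflect.α₂ = p.α₂⁻¹ := by
  simp [α₂, reflect, ← sub_eq_add_neg]

/-- Dividing `f` by `a Y` turns it into the same tau function in `X` and `Y⁻¹` with `a` replaced by
`a⁻¹`. -/
theorem f_eq_mul_reflect (A : ℝ) (z : ℂ) (t : ℝ) :
    p.f A z t = Real.exp (-A / 2) * p.Y z t * p.reflect.f (-A) z t := by
  have hY := p.Y_ne_zero z t
  have ha : Real.exp (-A / 2) * Real.exp (-(-A) / 2) = 1 := by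
    rw [← Real.exp_add, ← Real.exp_zero]
    congr 1
    ring
  have ha' : (Real.exp (-A / 2) : ℂ) * Real.exp (-(-A) / 2) = 1 := by exact_mod_cast ha
  rw [f_eq_tau, f_eq_tau, X_reflect, Y_reflect]
  generalize Real.exp (-A / 2) = a, Real.exp (-(-A) / 2) = b at *
  simp only [tau, reflect]
  generalize (Real.exp p.φ₁)⁻¹ = r
  field_simp
  linear_combination (-1 - r * p.X z t * p.Y z t) * ha'

theorem g_eq_mul_reflect (A γ : ℝ) (hα : p.α₂ ≠ 0) (z : ℂ) (t : ℝ) :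
    p.g A γ z t = Real.exp (-A / 2) * p.Y z t * p.reflect.g (-A) (γ * p.α₂) z t := by
  have hY := p.Y_ne_zero z t
  have ha : Real.exp (-A / 2) * Real.exp (-(-A) / 2) = 1 := by
    rw [← Real.exp_add, ← Real.exp_zero]
    congr 1
    ring
  have ha' : (Real.exp (-A / 2) : ℂ) * Real.exp (-(-A) / 2) = 1 := by exact_mod_cast ha
  have hα' : (p.α₂ : ℂ) ≠ 0 := by exact_mod_cast hα
  rw [g_eq_num, g_eq_num, X_reflect, Y_reflect, α₂_reflect]
  generalize Real.exp (-A / 2) = a, Real.exp (-(-A) / 2) = b at *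
  simp only [num, reflect, Complex.ofReal_inv, Complex.ofReal_mul]
  generalize ((Real.exp p.φ₁ : ℂ))⁻¹ = r
  field_simp
  linear_combination (-γ * p.X z t * r * p.α₂ * p.Y z t) * ha'

theorem u_eq_reflect (A γ : ℝ) (hα : p.α₂ ≠ 0) :
    p.u A γ = p.reflect.u (-A) (γ * p.α₂) := by
  ext x t
  have hY := p.Y_ne_zero x t
  have ha : (Real.exp (-A / 2) : ℂ) ≠ 0 := by exact_mod_cast Real.exp_ne_zero _
  rw [u, u, f_eq_mul_reflect, g_eq_mul_reflect _ _ _ hα, mul_div_mul_left _ _ (mul_ne_zero ha hY)]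

/-! ### The admissible range of the speed -/

/-- On the admissible range of `c₂` the four factors `c₂ ± k₂`, `c₂ + 2 k₁ ± k₂` have a common
sign. -/
theorem factors_pos_or_neg (p : Params) (hk₁ : 0 < p.k₁)
    (hc₂ : |p.k₂| < p.c₂ ∨ p.c₂ < -|p.k₂| - 2 * p.k₁) :
    (0 < p.c₂ - p.k₂ ∧ 0 < p.c₂ + p.k₂ ∧ 0 < p.c₂ + 2 * p.k₁ + p.k₂ ∧
      0 < p.c₂ + 2 * p.k₁ - p.k₂) ∨
    (p.c₂ - p.k₂ < 0 ∧ p.c₂ + p.k₂ < 0 ∧ p.c₂ + 2 * p.k₁ + p.k₂ < 0 ∧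
      p.c₂ + 2 * p.k₁ - p.k₂ < 0) := by
  have h1 := le_abs_self p.k₂
  have h2 := neg_le_abs p.k₂
  rcases hc₂ with h | h
  · left
    refine ⟨?_, ?_, ?_, ?_⟩ <;> linarith
  · right
    refine ⟨?_, ?_, ?_, ?_⟩ <;> linarith

theorem interaction_eq (p : Params) : p.interaction =
    ((p.c₂ - p.k₂) * (p.c₂ + 2 * p.k₁ + p.k₂)) / ((p.c₂ + p.k₂) * (p.c₂ + 2 * p.k₁ - p.k₂)) := by
  rw [interaction, c₁]
  congr 1 <;> ring

theorem interaction_pos (p : Params) (hk₁ : 0 < p.k₁)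
    (hc₂ : |p.k₂| < p.c₂ ∨ p.c₂ < -|p.k₂| - 2 * p.k₁) : 0 < p.interaction := by
  rw [interaction_eq]
  rcases p.factors_pos_or_neg hk₁ hc₂ with ⟨h1, h2, h3, h4⟩ | ⟨h1, h2, h3, h4⟩
  · positivity
  · exact div_pos (mul_pos_of_neg_of_neg h1 h3) (mul_pos_of_neg_of_neg h2 h4)

theorem gammaSq_pos (p : Params) (hk₁ : 0 < p.k₁) (hφ₁ : 0 < p.φ₁)
    (hc₂ : |p.k₂| < p.c₂ ∨ p.c₂ < -|p.k₂| - 2 * p.k₁) : 0 < p.gammaSq := by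
  have he : 0 < Real.exp (2 * p.φ₁) - 1 := sub_pos.2 (Real.one_lt_exp_iff.2 (by positivity))
  refine mul_pos (mul_pos hk₁ he) ?_
  rcases p.factors_pos_or_neg hk₁ hc₂ with ⟨h1, h2, -, -⟩ | ⟨h1, h2, -, -⟩
  · exact div_pos h2 h1
  · exact div_pos_of_neg_of_neg h2 h1

theorem exp_neg_half_sq (A : ℝ) : Real.exp (-A / 2) ^ 2 = Real.exp (-A) := by
  rw [← Real.exp_nat_mul]
  congr 1
  push_cast
  ring

theorem isAdmissible {p : Params} {A γ : ℝ} (hk₁ : 0 < p.k₁) (hφ₁ : 0 < p.φ₁) (hk₂ : p.k₂ ≠ 0)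
    (hc₂ : |p.k₂| < p.c₂ ∨ p.c₂ < -|p.k₂| - 2 * p.k₁)
    (hA : Real.exp (-A) = p.interaction) (hγ : γ ^ 2 = p.gammaSq) : p.IsAdmissible A γ := by
  have hne : p.c₂ - p.k₂ ≠ 0 ∧ p.c₂ + p.k₂ ≠ 0 ∧ p.c₂ + 2 * p.k₁ - p.k₂ ≠ 0 := by
    rcases p.factors_pos_or_neg hk₁ hc₂ with ⟨h1, h2, -, h4⟩ | ⟨h1, h2, -, h4⟩
    · exact ⟨h1.ne', h2.ne', h4.ne'⟩
    · exact ⟨h1.ne, h2.ne, h4.ne⟩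
  obtain ⟨h1, h2, h4⟩ := hne
  rw [interaction_eq, ← exp_neg_half_sq] at hA
  constructor
  · exact hk₁
  · exact hφ₁
  · exact div_ne_zero h1 h2
  · rw [hA, α₂]
    field_simp
    ring
  · rw [α₂]
    field_simp
  · rw [hγ, gammaSq, α₂, ← Real.exp_nat_mul]
    push_cast
    field_simp
  · rw [hA, α₂]
    -- `field_simp` looks for this factor with the product in normal form
    have h4' : p.c₂ + p.k₁ * 2 - p.k₂ ≠ 0 := by rwa [mul_comm p.k₁]
    field_simp
    ring
  · intro h
    rw [h, one_pow, eq_div_iff (mul_ne_zero h2 h4)] at hA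
    have : p.k₁ * p.k₂ = 0 := by linear_combination hA / 4
    exact mul_ne_zero hk₁.ne' hk₂ this

theorem exp_neg_half_lt_one {p : Params} {A : ℝ} (hk₁ : 0 < p.k₁) (hk₂ : 0 < p.k₂)
    (hc₂ : |p.k₂| < p.c₂ ∨ p.c₂ < -|p.k₂| - 2 * p.k₁)
    (hA : Real.exp (-A) = p.interaction) : Real.exp (-A / 2) < 1 := by
  have hden : 0 < (p.c₂ + p.k₂) * (p.c₂ + 2 * p.k₁ - p.k₂) := by
    rcases p.factors_pos_or_neg hk₁ hc₂ with ⟨-, h2, -, h4⟩ | ⟨-, h2, -, h4⟩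
    · exact mul_pos h2 h4
    · exact mul_pos_of_neg_of_neg h2 h4
  rw [interaction_eq, ← exp_neg_half_sq] at hA
  have h : Real.exp (-A / 2) ^ 2 < 1 := by
    -- numerator and denominator differ by `4 k₁ k₂`
    rw [hA, div_lt_one hden]
    nlinarith [mul_pos hk₁ hk₂]
  exact (sq_lt_one_iff₀ (Real.exp_pos _).le).1 h

theorem interaction_reflect (p : Params) : p.reflect.interaction = p.interaction⁻¹ := by
  rw [interaction, interaction, inv_div]
  simp only [reflect, c₁]
  congr 1
  ring

theorem gammaSq_reflect (p : Params) (hα : p.α₂ ≠ 0) :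
    p.reflect.gammaSq = p.gammaSq * p.α₂ ^ 2 := by
  have h : p.c₂ - p.k₂ ≠ 0 ∧ p.c₂ + p.k₂ ≠ 0 := by
    rwa [α₂, div_ne_zero_iff] at hα
  obtain ⟨h1, h2⟩ := h
  simp only [gammaSq, reflect, α₂, sub_neg_eq_add, ← sub_eq_add_neg]
  field_simp

end Params

end NDNLS

end

theorem mainTheorem4 (p : NDNLS.Params)
    (hk₁ : 0 < p.k₁) (hφ₁ : 0 < p.φ₁) (hk₂ : p.k₂ ≠ 0)
    (hc₂ : |p.k₂| < p.c₂ ∨ p.c₂ < -|p.k₂| - 2 * p.k₁) :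
    -- the two expressions for the interaction coefficient agree
    p.interaction =
        ((p.c₂ - p.k₂) * (p.c₂ + 2 * p.k₁ + p.k₂)) /
          ((p.c₂ + p.k₂) * (p.c₂ + 2 * p.k₁ - p.k₂)) ∧
    -- admissible real constants `A₁₂`, `γ₁₂` exist
    (∃ A γ : ℝ, Real.exp (-A) = p.interaction ∧ γ ^ 2 = p.gammaSq ∧ 0 < γ) ∧
    -- every admissible choice gives a two-periodic wave of the focusing model
    ∀ A γ : ℝ, Real.exp (-A) = p.interaction → γ ^ 2 = p.gammaSq →
      NDNLS.IsClassicalSolution (-1) (p.u A γ) ∧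
      NDNLS.IsTwoPeriodicWave p.k₁ p.k₂ p.c₁ p.c₂ (p.u A γ) ∧
      NDNLS.HasBilinearRepresentation (p.u A γ)
        (p.f A) (p.fTilde A) (p.g A γ) (p.gTilde A γ) ∧
      (∀ (t : ℝ) (z : ℂ), p.f A z t = 0 → z.im < 0) ∧
      (∀ (t : ℝ) (z : ℂ), p.fTilde A z t = 0 → 0 < z.im) := by
  have hI := p.interaction_pos hk₁ hc₂
  have hΓ := p.gammaSq_pos hk₁ hφ₁ hc₂
  refine ⟨p.interaction_eq, ⟨-Real.log p.interaction, √p.gammaSq, ?_, Real.sq_sqrt hΓ.le,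
    Real.sqrt_pos.2 hΓ⟩, fun A γ hA hγ => ?_⟩
  · rw [neg_neg, Real.exp_log hI]
  have h := NDNLS.Params.isAdmissible hk₁ hφ₁ hk₂ hc₂ hA hγ
  have key : NDNLS.IsClassicalSolution (-1) (p.u A γ) ∧
      ∀ (t : ℝ) (z : ℂ), p.f A z t = 0 → z.im < 0 := by
    rcases hk₂.lt_or_gt with hneg | hpos
    · have hk₂' : 0 < p.reflect.k₂ := neg_pos.2 hneg
      have hc₂' : |p.reflect.k₂| < p.reflect.c₂ ∨
          p.reflect.c₂ < -|p.reflect.k₂| - 2 * p.reflect.k₁ := by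
        simpa [NDNLS.Params.reflect] using hc₂
      have hA' : Real.exp (-(-A)) = p.reflect.interaction := by
        rw [p.interaction_reflect, ← hA, Real.exp_neg (-A)]
      have hγ' : (γ * p.α₂) ^ 2 = p.reflect.gammaSq := by
        rw [p.gammaSq_reflect h.α₂_ne_zero, mul_pow, hγ]
      have h' := NDNLS.Params.isAdmissible (p := p.reflect) hk₁ hφ₁ hk₂'.ne' hc₂' hA' hγ'
      have ha := NDNLS.Params.exp_neg_half_lt_one (p := p.reflect) hk₁ hk₂' hc₂' hA'
      refine ⟨?_, fun t z hz => ?_⟩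
      · rw [p.u_eq_reflect A γ h.α₂_ne_zero]
        exact h'.isClassicalSolution_of_pos hk₂' ha
      · rw [p.f_eq_mul_reflect] at hz
        refine h'.im_neg_of_f_eq_zero hk₂' ha ((mul_eq_zero.1 hz).resolve_left ?_)
        exact mul_ne_zero (by exact_mod_cast Real.exp_ne_zero _) (p.Y_ne_zero z t)
    · have ha := NDNLS.Params.exp_neg_half_lt_one hk₁ hpos hc₂ hA
      exact ⟨h.isClassicalSolution_of_pos hpos ha, fun t z => h.im_neg_of_f_eq_zero hpos ha⟩
  refine ⟨key.1, h.isTwoPeriodicWave, h.hasBilinearRepresentation, key.2, fun t z hz => ?_⟩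
  have := key.2 t _ ((p.fTilde_eq_zero_iff A z t).1 hz)
  rwa [Complex.conj_im, neg_lt_zero] at this
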